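/- Let $d\ge 2$ and let $\mathbb{T}_d$ be the homogeneous tree in which every vertex has $d+1$ neighbours, with a distinguished vertex $o$. Consider the frog model on $\mathbb{T}_d$ with parameter $p\in(0,1)$. At time $0$ there is one particle at each vertex; the particle at $o$ is active and all the others are inactive. From its activation on, a particle performs, independently of everything else, a simple random walk on $\mathbb{T}_d$ in discrete time, and makes a random number $L$ of jumps, where $\mathbb{P}(L=k)=(1-p)p^k$ for $k\ge 0$, after which it is removed. An inactive particle is activated as soon as an active particle visits its vertex. The process survives if at every time there is at least one active particle. Let $\theta(d,p)$ be the probability of survival, and let $p_c^{o}(d)=\inf\{p\in(0,1):\theta(d,p)>0\}$. Then $\{p\in(0,1):\theta(d,p)>0\}$ is non-empty for every $d\ge 2$. Moreover $p_c^{o}(2)\le 0.720836$, and for every $d\ge 3$ $$p_c^{o}(d)\le \frac{(d+1)\left[(7d-1)-\sqrt{(7d-1)^2-14}\right]}{d(7d-1)^2-7d+2-d(7d-1)\sqrt{(7d-1)^2-14}}<\frac{d+1}{2d}.$$ -/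

import Mathlib

open MeasureTheory ProbabilityTheory
open scoped ENNReal

namespace FrogModel

universe u

/-- The randomness attached to one particle: a sequence of maps `φ₀, φ₁, … : V → V` that drive its
walk (at its `n`-th jump, a particle sitting at `x` jumps to `φₙ x`), and its lifetime, that is,
the number of jumps it makes, once activated, before it is removed. -/
def Particle (V : Type u) : Type u := (ℕ → V → V) × ℕ

namespace Particle

variable {V : Type u}

/-- The maps that drive the walk of the particle. -/
def moves (x : Particle V) : ℕ → V → V := x.1

/-- The number of jumps that the particle makes before it is removed. -/
def lifetime (x : Particle V) : ℕ := x.2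

end Particle

/-- The product sigma-algebra, the vertex set being discrete. -/
instance (V : Type u) : MeasurableSpace (Particle V) :=
  letI : MeasurableSpace V := ⊤
  inferInstanceAs (MeasurableSpace ((ℕ → V → V) × ℕ))

/-- The walk started at `v` and driven by the maps `φₙ`: `S₀ = v` and `Sₙ₊₁ = φₙ Sₙ`. -/
def walk {V : Type u} (φ : ℕ → V → V) (v : V) : ℕ → V
  | 0 => v
  | n + 1 => φ n (walk φ v n)

/-- The law of one particle on a locally finite graph without isolated vertices. The values `φₙ x`
are independent over all `n` and `x`, and `φₙ x` is uniform among the neighbours of `x`; hence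
`walk φ v` is the simple random walk on `G` started at `v`. The lifetime `L` is independent of the
walk and geometric with parameter `1 - p`: `ℙ(L = k) = (1 - p) * p ^ k` for `k = 0, 1, 2, …`
(for `p < 1`), i.e. before each jump the particle is removed with probability `1 - p`. -/
noncomputable def particleLaw {V : Type u} (G : SimpleGraph V) (p : unitInterval) :
    Measure (Particle V) :=
  letI : MeasurableSpace V := ⊤
  (Measure.infinitePi fun _ : ℕ => Measure.infinitePi fun x : V => uniformOn (G.neighborSet x)).prod
    (geometricMeasure (unitInterval.symm p))

/-- The law of the whole system: one particle per vertex, independent and with the same law. -/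
noncomputable def frogLaw {V : Type u} (G : SimpleGraph V) (p : unitInterval) :
    Measure (V → Particle V) :=
  Measure.infinitePi fun _ : V => particleLaw G p

/-- `Reaches o ω v t`: there is a chain of particles, the first one being the particle of `o`
starting at time `0`, each particle of the chain starting to walk when the previous one (still
alive) sits at its vertex, and such that `v` is reached in this way at time `t`. The least such
`t` is the time at which the particle of `v` is activated. -/
inductive Reaches {V : Type u} (o : V) (ω : V → Particle V) : V → ℕ → Prop
  | root : Reaches o ω o 0
  | step {v : V} {t n : ℕ} (h : Reaches o ω v t) (hn : n ≤ (ω v).lifetime) :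
      Reaches o ω (walk (ω v).moves v n) (t + n)

/-- The particle of `v` is activated at time `t`. -/
def ActivatedAt {V : Type u} (o : V) (ω : V → Particle V) (v : V) (t : ℕ) : Prop :=
  IsLeast {s | Reaches o ω v s} t

/-- The particle of `v` is active (activated and not yet removed) at time `t`. -/
def ActiveAt {V : Type u} (o : V) (ω : V → Particle V) (v : V) (t : ℕ) : Prop :=
  ∃ s, ActivatedAt o ω v s ∧ s ≤ t ∧ t ≤ s + (ω v).lifetime

/-- The process started from the particle of `o` survives: at every time there is at least one
active particle. -/
def Survives {V : Type u} (o : V) (ω : V → Particle V) : Prop :=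
  ∀ t, ∃ v, ActiveAt o ω v t

/-- The probability of survival `θ(p)`. -/
noncomputable def survivalProb {V : Type u} (G : SimpleGraph V) (o : V) (p : unitInterval) : ℝ≥0∞ :=
  frogLaw G p {ω | Survives o ω}

/-- The set of the `p ∈ (0, 1)` for which the process survives with positive probability. -/
def supercritical {V : Type u} (G : SimpleGraph V) (o : V) : Set ℝ :=
  {x | ∃ p : unitInterval, (p : ℝ) = x ∧ 0 < p ∧ p < 1 ∧ 0 < survivalProb G o p}

/-- The critical parameter `inf {p : θ(p) > 0}`. -/
noncomputable def criticalParam {V : Type u} (G : SimpleGraph V) (o : V) : ℝ :=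
  sInf (supercritical G o)

end FrogModel

/-! Keep only the visits from a vertex to its descendants in a rooted `d`-ary tree of words embedded
in the graph. With `p = (d + 1) b / (1 + d b ^ 2)`, a particle ever visits a given vertex at
distance `k` with probability `b ^ k` (`measureReal_visits`), and distinct particles are
independent.

Call a path towards descendants covered if each vertex after its start is visited by a particle
sitting earlier on the path; if the start is activated, so is the end. Splitting according to the
nearest particle that hits the end gives a renewal equation for the probability of being covered,
with increments `lastHit b` (`coverProb_le_measureReal`). If `∑ d ^ (i + 1) * lastHit b i > 1`, then
for some `n` the mean number of covered paths of length `n` exceeds `1`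
(`exists_one_lt_of_renewal`). Concatenating such paths gives a supercritical branching structure,
which persists with positive probability by a weighted second moment bound
(`le_measureReal_branching`). Infinitely many activated vertices force survival
(`survives_of_infinite`).

It remains to choose `b`. For `d = 2` a finite sum at `b = 0.277` suffices. For `d ≥ 3` the products
in `lastHit` are bounded below by `1 - b - b ^ 2`, and a further simplification leaves a quadratic
equation, whose smaller root gives the stated bound. -/

namespace FrogModel

/-! ### Independence of sigma-algebras generated by disjoint sets of particles. -/

section Independence

variable {Ω ι : Type*} {mΩ : MeasurableSpace Ω} {μ : Measure Ω} {m : ι → MeasurableSpace Ω}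

/-- The sigma-algebra generated by the `m i` for `i ∈ S`. -/
@[reducible] def sigmaOn (m : ι → MeasurableSpace Ω) (S : Set ι) : MeasurableSpace Ω := ⨆ i ∈ S, m i

lemma sigmaOn_mono {S T : Set ι} (h : S ⊆ T) : sigmaOn m S ≤ sigmaOn m T :=
  biSup_mono h

lemma measurableSet_sigmaOn {S : Set ι} {i : ι} (hi : i ∈ S) {A : Set Ω}
    (hA : MeasurableSet[m i] A) : MeasurableSet[sigmaOn m S] A :=
  le_biSup m hi A hA

lemma sigmaOn_le (hm : ∀ i, m i ≤ mΩ) (S : Set ι) : sigmaOn m S ≤ mΩ :=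
  iSup₂_le fun i _ => hm i

lemma measureReal_inter_of_disjoint (hm : ∀ i, m i ≤ mΩ) (hind : iIndep m μ) {S T : Set ι}
    (hST : Disjoint S T) {A B : Set Ω} (hA : MeasurableSet[sigmaOn m S] A)
    (hB : MeasurableSet[sigmaOn m T] B) : μ.real (A ∩ B) = μ.real A * μ.real B := by
  have h := indep_iSup_of_disjoint hm hind hST
  rw [Measure.real, (Indep_iff _ _ _).1 h A B hA hB, ENNReal.toReal_mul]
  rfl

end Independence

/-! ### Covered paths in the tree of words and their renewal equation. -/

section Words

variable {Ω α : Type*} {mΩ : MeasurableSpace Ω} {μ : Measure Ω} {m : List α → MeasurableSpace Ω}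
  {A : List α → List α → Set Ω} {b : ℝ}

/-- Given the events `A l s` that the particle of the word `l` visits its descendant `s ++ l`, the
event that each vertex strictly above `l` on the path from `l` to `s ++ l` is visited by a particle
sitting below it on this path. -/
def covered (A : List α → List α → Set Ω) (l : List α) : List α → Set Ω
  | [] => Set.univ
  | a :: s => covered A l s ∩ ⋃ i ∈ Finset.range (s.length + 1), A (s.drop i ++ l) (a :: s.take i)

lemma mem_covered_append (hmono : ∀ l s t, A l (t ++ s) ⊆ A l s) {l q r : List α} {ω : Ω}
    (hr : ω ∈ covered A l r) (hq : ω ∈ A (r ++ l) q) : ω ∈ covered A l (q ++ r) := by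
  induction q with
  | nil => simpa using hr
  | cons a q ih =>
    refine ⟨ih (hmono _ q [a] hq), ?_⟩
    simp only [Set.mem_iUnion, Finset.mem_range]
    exact ⟨q.length, by simp, by simpa using hq⟩

/-- The conclusion is about every vertex of the path, not only its end, because the particle that
hits the end may sit anywhere on it. -/
lemma mem_of_mem_covered {R : List α → Prop} {ω : Ω}
    (hR : ∀ l s, R l → ω ∈ A l s → R (s ++ l)) {l s : List α} (hl : R l)
    (hs : ω ∈ covered A l s) (i : ℕ) : R (s.drop i ++ l) := by
  induction s generalizing i with
  | nil => simpa using hl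
  | cons a s ih =>
    obtain ⟨hs, ha⟩ := hs
    cases i with
    | succ i => simpa using ih hs i
    | zero =>
      simp only [Set.mem_iUnion] at ha
      obtain ⟨j, -, hj⟩ := ha
      have := hR _ _ (ih hs j) hj
      simpa [← List.append_assoc] using this

/-- The strict length bound says that the particle at the end of the path is not used; this makes
the event independent of what happens from the end onwards. -/
lemma measurableSet_covered (hA : ∀ l s, MeasurableSet[m l] (A l s)) (l s : List α) :
    MeasurableSet[sigmaOn m {l' | l <:+ l' ∧ l'.length < l.length + s.length}]
      (covered A l s) := by
  induction s with
  | nil => exact MeasurableSet.univ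
  | cons a s ih =>
    refine MeasurableSet.inter (sigmaOn_mono (fun l' h => ?_) _ ih)
      (Finset.measurableSet_biUnion _ fun i _ => measurableSet_sigmaOn ?_ (hA _ _))
    · simp only [Set.mem_ofPred_eq, List.length_cons] at h ⊢
      exact ⟨h.1, by omega⟩
    · simp only [Set.mem_ofPred_eq, List.length_cons, List.length_append, List.length_drop]
      exact ⟨List.suffix_append _ _, by omega⟩

/-- The probability that a given descendant at distance `i + 1` is visited by a particle but by
none of the `i` particles in between, if a particle visits a given descendant at distance `k` with
probability `b ^ k`. -/
noncomputable def lastHit (b : ℝ) (i : ℕ) : ℝ :=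
  b ^ (i + 1) * ∏ j ∈ Finset.range i, (1 - b ^ (j + 1))

/-- The renewal sequence whose increments have the law `lastHit b`: the probability that a path of
a given length is covered. -/
noncomputable def coverProb (b : ℝ) : ℕ → ℝ
  | 0 => 1
  | n + 1 => ∑ i : Fin (n + 1), lastHit b i * coverProb b (n - i)

lemma coverProb_succ (b : ℝ) (n : ℕ) :
    coverProb b (n + 1) = ∑ i ∈ Finset.range (n + 1), lastHit b i * coverProb b (n - i) := by
  rw [coverProb, Finset.sum_range]

variable [IsProbabilityMeasure μ]

/-- The particles involved sit at the distinct vertices `s.drop j ++ l`, hence are independent; `i ≤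
s.length + 1` keeps these vertices distinct. -/
lemma measureReal_biInter_compl (hm : ∀ l, m l ≤ mΩ) (hind : iIndep m μ)
    (hA : ∀ l s, MeasurableSet[m l] (A l s)) (hP : ∀ l s, μ.real (A l s) = b ^ s.length)
    (l s : List α) (a : α) {i : ℕ} (hi : i ≤ s.length + 1) :
    MeasurableSet[sigmaOn m {l' | l.length + s.length < l'.length + i}]
      (⋂ j ∈ Finset.range i, (A (s.drop j ++ l) (a :: s.take j))ᶜ) ∧
    μ.real (⋂ j ∈ Finset.range i, (A (s.drop j ++ l) (a :: s.take j))ᶜ) =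
      ∏ j ∈ Finset.range i, (1 - b ^ (j + 1)) := by
  induction i with
  | zero => simp
  | succ i ih =>
    obtain ⟨ih1, ih2⟩ := ih (by omega)
    have hmem : MeasurableSet[m (s.drop i ++ l)] (A (s.drop i ++ l) (a :: s.take i))ᶜ :=
      (hA _ _).compl
    rw [Finset.range_add_one, Finset.set_biInter_insert, Set.inter_comm]
    constructor
    · refine MeasurableSet.inter (sigmaOn_mono (fun l' h => ?_) _ ih1)
        (measurableSet_sigmaOn ?_ hmem)
      · simp only [Set.mem_ofPred_eq] at h ⊢; omega
      · simp only [Set.mem_ofPred_eq, List.length_append, List.length_drop]; omega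
    · have hdisj : Disjoint {l' : List α | l.length + s.length < l'.length + i} {s.drop i ++ l} := by
        simp only [Set.disjoint_singleton_right, Set.mem_ofPred_eq, List.length_append,
          List.length_drop]; omega
      have hlen : (a :: s.take i).length = i + 1 := by simp; omega
      have hmem' : MeasurableSet[sigmaOn m {s.drop i ++ l}]
          (A (s.drop i ++ l) (a :: s.take i))ᶜ := measurableSet_sigmaOn (Set.mem_singleton _) hmem
      have := measureReal_inter_of_disjoint hm hind hdisj ih1 hmem'
      rw [this, ih2, ← Finset.range_add_one, Finset.prod_range_succ,
        probReal_compl_eq_one_sub (hm _ _ (hA _ _)), hP, hlen]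

/-- In the event `D i`, the path is covered up to the particle at distance `i + 1` from the end,
this particle hits the end, and no nearer one does. The three conditions concern disjoint sets of
particles, and the `D i` are disjoint. By `hmono` the hitting particle also covers the vertices in
between. -/
lemma coverProb_le_measureReal (hm : ∀ l, m l ≤ mΩ) (hind : iIndep m μ)
    (hA : ∀ l s, MeasurableSet[m l] (A l s)) (hP : ∀ l s, μ.real (A l s) = b ^ s.length)
    (hb0 : 0 ≤ b) (hb1 : b ≤ 1)
    (hmono : ∀ l s t, A l (t ++ s) ⊆ A l s) (l s : List α) :
    coverProb b s.length ≤ μ.real (covered A l s) := by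
  induction h : s.length using Nat.strong_induction_on generalizing s with
  | _ n ih =>
  subst h
  cases s with
  | nil => simp [covered, coverProb]
  | cons a s =>
    set F : ℕ → Set Ω := fun i => A (s.drop i ++ l) (a :: s.take i) with hF
    set N : ℕ → Set Ω := fun i => ⋂ j ∈ Finset.range i, (F j)ᶜ with hN
    set D : ℕ → Set Ω := fun i => covered A l (s.drop i) ∩ (N i ∩ F i) with hD
    have hcov (r : List α) := measurableSet_covered hA l r
    have hNi {i : ℕ} (hi : i ∈ Finset.range (s.length + 1)) :=
      measureReal_biInter_compl hm hind hA hP l s a (i := i) (by simp at hi; omega)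
    have hprob (i : ℕ) (hi : i ∈ Finset.range (s.length + 1)) :
        lastHit b i * coverProb b (s.length - i) ≤ μ.real (D i) := by
      have hi' : i < s.length + 1 := by simpa using hi
      have hFi : MeasurableSet[m (s.drop i ++ l)] (F i) := hA _ _
      have hd1 : Disjoint {l' : List α | l.length + s.length < l'.length + i}
          {s.drop i ++ l} := by
        simp only [Set.disjoint_singleton_right, Set.mem_ofPred_eq, List.length_append,
          List.length_drop]; omega
      have hd2 : Disjoint {l' : List α | l <:+ l' ∧ l'.length < l.length + (s.drop i).length}
          {l' | l.length + s.length < l'.length + (i + 1)} := by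
        refine Set.disjoint_left.2 fun l' h1 h2 => ?_
        simp only [Set.mem_ofPred_eq, List.length_drop] at h1 h2; omega
      have hNF : MeasurableSet[sigmaOn m {l' | l.length + s.length < l'.length + (i + 1)}]
          (N i ∩ F i) := by
        refine MeasurableSet.inter (sigmaOn_mono (fun l' h => ?_) _ (hNi hi).1)
          (measurableSet_sigmaOn ?_ hFi)
        · simp only [Set.mem_ofPred_eq] at h ⊢; omega
        · simp only [Set.mem_ofPred_eq, List.length_append, List.length_drop]; omega
      have e1 := measureReal_inter_of_disjoint hm hind hd2 (hcov (s.drop i)) hNF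
      have hFi' : MeasurableSet[sigmaOn m {s.drop i ++ l}] (F i) :=
        measurableSet_sigmaOn (Set.mem_singleton _) hFi
      have e2 := measureReal_inter_of_disjoint hm hind hd1 (hNi hi).1 hFi'
      have hlen : (a :: s.take i).length = i + 1 := by simp; omega
      have h1 := ih (s.length - i) (by simp) (s.drop i) (by simp)
      calc _ = coverProb b (s.length - i) *
            ((∏ j ∈ Finset.range i, (1 - b ^ (j + 1))) * b ^ (i + 1)) := by
            rw [lastHit]; ring
        _ ≤ μ.real (covered A l (s.drop i)) *
            ((∏ j ∈ Finset.range i, (1 - b ^ (j + 1))) * b ^ (i + 1)) := by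
            refine mul_le_mul_of_nonneg_right h1 (mul_nonneg ?_ (by positivity))
            exact Finset.prod_nonneg fun j _ => sub_nonneg.2 (pow_le_one₀ hb0 hb1)
        _ = μ.real (D i) := by
            rw [e1, e2, (hNi hi).2, hP, hlen]
    have hmeas (i : ℕ) (hi : i ∈ Finset.range (s.length + 1)) : MeasurableSet (D i) := by
      have h1 : MeasurableSet (covered A l (s.drop i)) := sigmaOn_le hm _ _ (hcov _)
      have h2 : MeasurableSet (N i) := sigmaOn_le hm _ _ (hNi hi).1
      have h3 : MeasurableSet (F i) := hm _ _ (hA _ _)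
      exact h1.inter (h2.inter h3)
    have hdisj : Set.PairwiseDisjoint (Finset.range (s.length + 1) : Set ℕ) D := by
      have key {i j : ℕ} (hij : i < j) : Disjoint (D i) (D j) := by
        refine Set.disjoint_left.2 fun ω h1 h2 => ?_
        have := h2.2.1
        simp only [hN, Set.mem_iInter] at this
        exact this i (by simpa using hij) h1.2.2
      intro i _ j _ hij
      rcases hij.lt_or_gt with h | h
      · exact key h
      · exact (key h).symm
    rw [List.length_cons, coverProb_succ]
    refine (Finset.sum_le_sum hprob).trans ?_
    rw [← measureReal_biUnion_finset hdisj hmeas]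
    refine measureReal_mono (Set.iUnion₂_subset fun i hi ω hω => ?_)
    have := mem_covered_append hmono hω.1 hω.2.2
    simpa using this

end Words

/-- With `X = ∑ w i * 1_{E i}`, the bound `2κX - κ²X² ≤ 1` is `(κX - 1)² ≥ 0`, and the left side
vanishes off the union; then integrate. -/
lemma two_mul_sub_le_measureReal_iUnion {Ω ι : Type*} [MeasurableSpace Ω] {μ : Measure Ω}
    [IsProbabilityMeasure μ] [Fintype ι] {E : ι → Set Ω} (hE : ∀ i, MeasurableSet (E i))
    (w : ι → ℝ) (κ : ℝ) :
    2 * κ * (∑ i, w i * μ.real (E i)) - κ ^ 2 * (∑ i, ∑ j, w i * w j * μ.real (E i ∩ E j)) ≤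
      μ.real (⋃ i, E i) := by
  have hint (S : Set Ω) (hS : MeasurableSet S) : Integrable (S.indicator (1 : Ω → ℝ)) μ :=
    (integrable_const 1).indicator hS
  have h1 : ∫ ω, (2 * κ * (∑ i, w i * (E i).indicator (1 : Ω → ℝ) ω) -
      κ ^ 2 * (∑ i, ∑ j, w i * w j * (E i ∩ E j).indicator (1 : Ω → ℝ) ω)) ∂μ =
      2 * κ * (∑ i, w i * μ.real (E i)) -
        κ ^ 2 * (∑ i, ∑ j, w i * w j * μ.real (E i ∩ E j)) := by
    have i1 (i : ι) : Integrable (fun ω => w i * (E i).indicator (1 : Ω → ℝ) ω) μ :=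
      (hint _ (hE i)).const_mul _
    have i2 (i j : ι) : Integrable (fun ω => w i * w j * (E i ∩ E j).indicator (1 : Ω → ℝ) ω) μ :=
      (hint _ ((hE i).inter (hE j))).const_mul _
    rw [integral_sub ((integrable_finsetSum _ fun i _ => i1 i).const_mul _)
      ((integrable_finsetSum _ fun i _ => integrable_finsetSum _ fun j _ => i2 i j).const_mul _),
      integral_const_mul, integral_const_mul, integral_finsetSum _ fun i _ => i1 i,
      integral_finsetSum _ fun i _ => integrable_finsetSum _ fun j _ => i2 i j]
    simp_rw [integral_finsetSum _ fun j _ => i2 _ j, integral_const_mul]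
    congr 3
    · ext i; rw [integral_indicator_one (hE i)]
    · ext i; congr 1; ext j; rw [integral_indicator_one ((hE i).inter (hE j))]
  rw [← h1, ← integral_indicator_one (MeasurableSet.iUnion hE)]
  refine integral_mono ?_ (hint _ (MeasurableSet.iUnion hE)) fun ω => ?_
  · exact ((integrable_finsetSum _ fun i _ => (hint _ (hE i)).const_mul _).const_mul _).sub
      ((integrable_finsetSum _ fun i _ => integrable_finsetSum _ fun j _ =>
        (hint _ ((hE i).inter (hE j))).const_mul _).const_mul _)
  · have hsq : ∑ i, ∑ j, w i * w j * (E i ∩ E j).indicator (1 : Ω → ℝ) ω =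
        (∑ i, w i * (E i).indicator (1 : Ω → ℝ) ω) ^ 2 := by
      rw [sq, Finset.sum_mul_sum]
      refine Finset.sum_congr rfl fun i _ => Finset.sum_congr rfl fun j _ => ?_
      rw [Set.inter_indicator_one]
      simp only [Pi.mul_apply]; ring
    simp only [hsq]
    by_cases hω : ω ∈ ⋃ i, E i
    · rw [Set.indicator_of_mem hω]
      simp only [Pi.one_apply]
      nlinarith [sq_nonneg (κ * (∑ i, w i * (E i).indicator (1 : Ω → ℝ) ω) - 1)]
    · have : ∀ i, (E i).indicator (1 : Ω → ℝ) ω = 0 := fun i =>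
        Set.indicator_of_notMem (fun h => hω (Set.mem_iUnion.2 ⟨i, h⟩)) _
      simp only [this, mul_zero, Finset.sum_const_zero]
      rw [Set.indicator_of_notMem hω]; simp

/-- Every `M` further steps gain a factor `S > 1`: `c * S ^ k ≤ x n` for `n ≥ k * M`, where `c` is
the minimum of the first `M` values. -/
lemma exists_one_lt_of_renewal {x a : ℕ → ℝ} {M : ℕ} (ha : ∀ i, 0 ≤ a i) (ha0 : 0 < a 0)
    (hx0 : x 0 = 1)
    (hx : ∀ n, x (n + 1) = ∑ i ∈ Finset.range (n + 1), a i * x (n - i))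
    (hM : 1 < ∑ i ∈ Finset.range M, a i) : ∃ n, 1 < x n := by
  set S := ∑ i ∈ Finset.range M, a i with hS
  have hM0 : 0 < M := by
    rcases Nat.eq_zero_or_pos M with h | h
    · subst h; simp at hS; linarith
    · exact h
  have hpos : ∀ n, 0 < x n := fun n => by
    induction n using Nat.strong_induction_on with
    | _ n ih =>
    cases n with
    | zero => simp [hx0]
    | succ n =>
      rw [hx]
      refine Finset.sum_pos' (fun i _ => mul_nonneg (ha i) (ih _ (by omega)).le) ⟨0, by simp, ?_⟩
      exact mul_pos ha0 (ih _ (by omega))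
  obtain ⟨n₀, -, hn₀⟩ := Finset.exists_min_image (Finset.range M) x ⟨0, by simpa using hM0⟩
  set c := x n₀ with hc
  have hc0 : 0 < c := hpos _
  have key : ∀ n k, k * M ≤ n → c * S ^ k ≤ x n := fun n => by
    induction n using Nat.strong_induction_on with
    | _ n ih =>
    intro k hk
    rcases lt_or_ge n M with hn | hn
    · obtain rfl : k = 0 := by
        by_contra h
        have := Nat.le_mul_of_pos_left M (Nat.pos_of_ne_zero h)
        omega
      simpa using hn₀ n (by simpa using hn)
    · obtain ⟨n, rfl⟩ : ∃ n', n = n' + 1 := ⟨n - 1, by omega⟩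
      have hle (k' : ℕ) (hk' : k' * M + M ≤ n + 1) : c * S ^ (k' + 1) ≤ x (n + 1) := by
        calc c * S ^ (k' + 1) = ∑ i ∈ Finset.range M, a i * (c * S ^ k') := by
              rw [← Finset.sum_mul, ← hS]; ring
          _ ≤ ∑ i ∈ Finset.range M, a i * x (n - i) := by
              refine Finset.sum_le_sum fun i hi => mul_le_mul_of_nonneg_left ?_ (ha i)
              have : i < M := by simpa using hi
              exact ih (n - i) (by omega) k' (by omega)
          _ ≤ x (n + 1) := by
              rw [hx]
              refine Finset.sum_le_sum_of_subset_of_nonneg (fun i hi => ?_) fun i _ _ =>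
                mul_nonneg (ha i) (hpos _).le
              simp only [Finset.mem_range] at hi ⊢; omega
      cases k with
      | zero =>
        refine le_trans ?_ (hle 0 (by omega))
        rw [pow_zero, pow_succ, pow_zero, one_mul]
        exact mul_le_mul_of_nonneg_left hM.le hc0.le
      | succ k => exact hle k (by rw [Nat.succ_mul] at hk; exact hk)
  obtain ⟨k, hk⟩ := pow_unbounded_of_one_lt c⁻¹ hM
  refine ⟨k * M, lt_of_lt_of_le ?_ (key _ k le_rfl)⟩
  rwa [inv_lt_iff_one_lt_mul₀' hc0] at hk

/-! ### Survival of the branching process of covered paths. -/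

section Branching

variable {Ω α : Type*} {mΩ : MeasurableSpace Ω} {μ : Measure Ω} {m : List α → MeasurableSpace Ω}
  {A : List α → List α → Set Ω} {b : ℝ}

/-- The event that the branching process of the covered paths of length `n`, started at `l`,
survives for `k` generations. -/
def branching (A : List α → List α → Set Ω) (n : ℕ) : ℕ → List α → Set Ω
  | 0, _ => Set.univ
  | k + 1, l => ⋃ s : Fin n → α, covered A l (List.ofFn s) ∩ branching A n k (List.ofFn s ++ l)

lemma branching_succ_subset (n k : ℕ) (l : List α) :
    branching A n (k + 1) l ⊆ branching A n k l := by
  induction k generalizing l with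
  | zero => exact Set.subset_univ _
  | succ k ih => exact Set.iUnion_mono fun s => Set.inter_subset_inter_right _ (ih _)

lemma exists_of_mem_branching {R : List α → Prop} {ω : Ω}
    (hR : ∀ l s, R l → ω ∈ A l s → R (s ++ l)) {n k : ℕ} {l : List α} (hl : R l)
    (h : ω ∈ branching A n k l) : ∃ s, R s ∧ s.length = k * n + l.length := by
  induction k generalizing l with
  | zero => exact ⟨l, hl, by simp⟩
  | succ k ih =>
    obtain ⟨s, hs, hk⟩ := Set.mem_iUnion.1 h
    obtain ⟨t, ht, hlen⟩ := ih (by simpa using mem_of_mem_covered hR hl hs 0) hk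
    refine ⟨t, ht, ?_⟩
    simp only [List.length_append, List.length_ofFn] at hlen
    rw [hlen]; ring

/-- Only particles in the subtree of `l` matter, so the events attached to distinct words of equal
length are independent. -/
lemma measurableSet_branching [Finite α] (hA : ∀ l s, MeasurableSet[m l] (A l s)) (n k : ℕ)
    (l : List α) : MeasurableSet[sigmaOn m {l' | l <:+ l'}] (branching A n k l) := by
  induction k generalizing l with
  | zero => exact MeasurableSet.univ
  | succ k ih =>
    refine MeasurableSet.iUnion fun s => MeasurableSet.inter ?_ ?_
    · exact sigmaOn_mono (fun l' h => h.1) _ (measurableSet_covered hA l _)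
    · exact sigmaOn_mono (fun l' h => (List.suffix_append _ _).trans h) _ (ih _)

variable [IsProbabilityMeasure μ] [Fintype α]

lemma le_measureReal_branching (hm : ∀ l, m l ≤ mΩ) (hind : iIndep m μ)
    (hA : ∀ l s, MeasurableSet[m l] (A l s)) {n : ℕ} {M c : ℝ} (hM1 : 1 < M)
    (hM : ∀ l, M ≤ ∑ s : Fin n → α, μ.real (covered A l (List.ofFn s)))
    (hc0 : 0 < c) (hc1 : c ≤ 1) (hc : (Fintype.card α : ℝ) ^ (2 * n) * c ≤ M ^ 2 - M) (k : ℕ)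
    (l : List α) : c ≤ μ.real (branching A n k l) := by
  induction k generalizing l with
  | zero => simpa [branching] using hc1
  | succ k ih =>
    set C : (Fin n → α) → Set Ω := fun s => covered A l (List.ofFn s) with hC
    set B : (Fin n → α) → Set Ω := fun s => branching A n k (List.ofFn s ++ l) with hB
    have hCm (s : Fin n → α) : MeasurableSet[sigmaOn m {l' | l <:+ l' ∧
        l'.length < l.length + (List.ofFn s).length}] (C s) := measurableSet_covered hA l _
    have hBm (s : Fin n → α) :
        MeasurableSet[sigmaOn m {l' | List.ofFn s ++ l <:+ l'}] (B s) :=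
      measurableSet_branching hA n k _
    have hCm' (s : Fin n → α) : MeasurableSet (C s) := sigmaOn_le hm _ _ (hCm s)
    have hBm' (s : Fin n → α) : MeasurableSet (B s) := sigmaOn_le hm _ _ (hBm s)
    have hCB (s : Fin n → α) : μ.real (C s ∩ B s) = μ.real (C s) * μ.real (B s) := by
      refine measureReal_inter_of_disjoint hm hind ?_ (hCm s) (hBm s)
      refine Set.disjoint_left.2 fun l' h1 h2 => ?_
      have := List.IsSuffix.length_le (h2 : List.ofFn s ++ l <:+ l')
      have := h1.2
      simp only [List.length_append] at *
      omega
    have hBB {s t : Fin n → α} (hst : s ≠ t) : μ.real (B s ∩ B t) = μ.real (B s) * μ.real (B t) := by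
      refine measureReal_inter_of_disjoint hm hind ?_ (hBm s) (hBm t)
      refine Set.disjoint_left.2 fun l' h1 h2 => hst ?_
      have := (List.suffix_of_suffix_length_le h1 h2 (by simp)).eq_of_length (by simp)
      exact List.ofFn_injective (List.append_cancel_right this)
    -- The probabilities of the `B s` are only known to be at least `c`; the weights bring them all
    -- down to exactly `c`.
    set w : (Fin n → α) → ℝ := fun s => c / μ.real (B s) with hw
    have hBpos (s : Fin n → α) : 0 < μ.real (B s) := hc0.trans_le (ih _)
    have hw0 (s : Fin n → α) : 0 ≤ w s := div_nonneg hc0.le (hBpos s).le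
    have hw1 (s : Fin n → α) : w s ≤ 1 := (div_le_one (hBpos s)).2 (ih _)
    have hwB (s : Fin n → α) : w s * μ.real (B s) = c := div_mul_cancel₀ _ (hBpos s).ne'
    set S := ∑ s, μ.real (C s) with hS
    have hMS : M ≤ S := hM l
    have h1 : ∑ s, w s * μ.real (C s ∩ B s) = c * S := by
      rw [hS, Finset.mul_sum]
      refine Finset.sum_congr rfl fun s _ => ?_
      rw [hCB, ← hwB s]; ring
    have h2 : ∑ s, ∑ t, w s * w t * μ.real ((C s ∩ B s) ∩ (C t ∩ B t)) ≤
        c * S + (Fintype.card α : ℝ) ^ (2 * n) * c ^ 2 := by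
      classical
      calc _ ≤ ∑ s, ∑ t, ((if s = t then w s * μ.real (C s ∩ B s) else 0) + c ^ 2) := by
            refine Finset.sum_le_sum fun s _ => Finset.sum_le_sum fun t _ => ?_
            split_ifs with h
            · subst h
              rw [Set.inter_self]
              have := mul_le_mul_of_nonneg_right (hw1 s)
                (mul_nonneg (hw0 s) (measureReal_nonneg (μ := μ) (s := C s ∩ B s)))
              nlinarith [sq_nonneg c]
            · rw [zero_add]
              -- `C s` and `C t` may share particles, so they are dropped; only the independence of
              -- `B s` and `B t` is used.
              have : μ.real ((C s ∩ B s) ∩ (C t ∩ B t)) ≤ μ.real (B s) * μ.real (B t) := by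
                rw [← hBB h]
                exact measureReal_mono fun ω hω => ⟨hω.1.2, hω.2.2⟩
              calc _ ≤ w s * w t * (μ.real (B s) * μ.real (B t)) :=
                    mul_le_mul_of_nonneg_left this (mul_nonneg (hw0 s) (hw0 t))
                _ = (w s * μ.real (B s)) * (w t * μ.real (B t)) := by ring
                _ = c ^ 2 := by rw [hwB, hwB, sq]
        _ = c * S + (Fintype.card α : ℝ) ^ (2 * n) * c ^ 2 := by
            simp only [Finset.sum_add_distrib, Finset.sum_ite_eq, Finset.mem_univ, if_true,
              Finset.sum_const, Finset.card_univ, Fintype.card_fun, Fintype.card_fin,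
              nsmul_eq_mul, h1]
            push_cast; ring
    -- With `κ = S⁻¹` the first moment term is `2c`; by `hc` the second moment term is at most `c`.
    have h3 := two_mul_sub_le_measureReal_iUnion (μ := μ)
      (fun s => (hCm' s).inter (hBm' s)) w S⁻¹
    refine le_trans ?_ h3
    rw [h1]
    have hS0 : 0 < S := by linarith
    have h4 := mul_le_mul_of_nonneg_left h2 (sq_nonneg S⁻¹)
    have h5 : S⁻¹ ^ 2 * (c * S + (Fintype.card α : ℝ) ^ (2 * n) * c ^ 2) ≤ c := by
      rw [inv_pow, inv_mul_le_iff₀ (by positivity)]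
      have h7 : (Fintype.card α : ℝ) ^ (2 * n) * c ≤ S ^ 2 - S := by
        nlinarith [mul_nonneg (sub_nonneg.2 hMS) (by linarith : 0 ≤ S + M - 1)]
      nlinarith [mul_le_mul_of_nonneg_left h7 hc0.le]
    have h6 : 2 * S⁻¹ * (c * S) = 2 * c := by field_simp
    linarith

/-- The frog model dominates a supercritical branching process, if a particle visits any given
descendant at distance `k` with probability `b ^ k` and if the mean number of the vertices whose
last hit comes from a given particle exceeds `1`. -/
theorem exists_measure_pos_of_one_lt (hm : ∀ l, m l ≤ mΩ) (hind : iIndep m μ)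
    (hA : ∀ l s, MeasurableSet[m l] (A l s)) (hP : ∀ l s, μ.real (A l s) = b ^ s.length)
    (hb0 : 0 < b) (hb1 : b ≤ 1) (hmono : ∀ l s t, A l (t ++ s) ⊆ A l s) {N : ℕ}
    (hN : 1 < ∑ i ∈ Finset.range N, (Fintype.card α : ℝ) ^ (i + 1) * lastHit b i) :
    ∃ S : Set Ω, 0 < μ S ∧ ∀ ω ∈ S, ∀ R : List α → Prop, R [] →
      (∀ l s, R l → ω ∈ A l s → R (s ++ l)) → ∀ k, ∃ s, R s ∧ k ≤ s.length := by
  set D : ℝ := (Fintype.card α : ℝ) with hD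
  have hD0 : 0 < D := by
    by_contra h
    have : D = 0 := le_antisymm (not_lt.1 h) (Nat.cast_nonneg _)
    simp [this] at hN
    linarith
  obtain ⟨n, hn⟩ : ∃ n, 1 < D ^ n * coverProb b n := by
    refine exists_one_lt_of_renewal (x := fun n => D ^ n * coverProb b n)
      (a := fun i => D ^ (i + 1) * lastHit b i) (M := N) (fun i => ?_) ?_ ?_ (fun n => ?_) hN
    · exact mul_nonneg (by positivity) (mul_nonneg (by positivity)
        (Finset.prod_nonneg fun j _ => sub_nonneg.2 (pow_le_one₀ hb0.le hb1)))
    · simp only [lastHit, Finset.range_zero, Finset.prod_empty]; positivity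
    · simp [coverProb]
    · rw [coverProb_succ, Finset.mul_sum]
      refine Finset.sum_congr rfl fun i hi => ?_
      have : D ^ (n + 1) = D ^ (i + 1) * D ^ (n - i) := by
        rw [← pow_add]; congr 1; simp at hi; omega
      rw [this]; ring
  set M := D ^ n * coverProb b n with hM
  have hn0 : n ≠ 0 := by
    rintro rfl
    simp [hM, coverProb] at hn
  have hMle (l : List α) : M ≤ ∑ s : Fin n → α, μ.real (covered A l (List.ofFn s)) := by
    calc M = ∑ s : Fin n → α, coverProb b n := by simp [hM, hD]
      _ ≤ _ := by
        refine Finset.sum_le_sum fun s _ => ?_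
        simpa using coverProb_le_measureReal hm hind hA hP hb0.le hb1 hmono l (List.ofFn s)
  set c := min 1 ((M ^ 2 - M) / D ^ (2 * n)) with hc
  have hMM : 0 < M ^ 2 - M := by nlinarith
  have hc0 : 0 < c := lt_min one_pos (by positivity)
  have hB := le_measureReal_branching hm hind hA hn hMle hc0 (min_le_left _ _) (by
    rw [← le_div_iff₀' (by positivity)]; exact min_le_right _ _)
  refine ⟨⋂ k, branching A n k [], ?_, fun ω hω R hR0 hR k => ?_⟩
  · have hanti : Antitone fun k => branching A n k [] :=
      antitone_nat_of_succ_le fun k => branching_succ_subset n k _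
    have hlim := tendsto_measure_iInter_atTop (μ := μ) (s := fun k => branching A n k [])
      (fun k => (sigmaOn_le hm _ _ (measurableSet_branching hA n k [])).nullMeasurableSet) hanti
      ⟨0, measure_ne_top _ _⟩
    refine lt_of_lt_of_le (ENNReal.ofReal_pos.2 hc0) (ge_of_tendsto' hlim fun k => ?_)
    exact (ENNReal.ofReal_le_iff_le_toReal (measure_ne_top _ _)).2 (hB k [])
  · obtain ⟨s, hs, hlen⟩ := exists_of_mem_branching hR hR0 (Set.mem_iInter.1 hω k)
    refine ⟨s, hs, ?_⟩
    rw [hlen]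
    exact (Nat.le_mul_of_pos_right k (Nat.pos_of_ne_zero hn0)).trans (Nat.le_add_right _ _)

end Branching

/-! ### Geometry of regular trees. -/

section Tree

variable {V : Type*} {G : SimpleGraph V}

/-- A geodesic through `y` is the only path from `x` to `z`, so removing the loops of any walk
yields it. -/
lemma mem_support_of_dist_add_dist (hG : G.IsTree) {x y z : V}
    (h : G.dist x y + G.dist y z = G.dist x z) (p : G.Walk x z) : y ∈ p.support := by
  classical
  obtain ⟨q, hq⟩ := hG.connected.exists_walk_length_eq_dist x y
  obtain ⟨r, hr⟩ := hG.connected.exists_walk_length_eq_dist y z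
  have hqr : (q.append r).IsPath :=
    SimpleGraph.Walk.isPath_of_length_eq_dist _ (by rw [SimpleGraph.Walk.length_append]; omega)
  have := (hG.isAcyclic.subsingleton_path x z).elim ⟨q.append r, hqr⟩ ⟨p.bypass, p.bypass_isPath⟩
  have h2 : q.append r = p.bypass := congrArg Subtype.val this
  refine p.support_bypass_subset_support ?_
  rw [← h2, SimpleGraph.Walk.mem_support_append_iff]
  exact Or.inl q.end_mem_support

lemma eq_of_adj_of_dist_add_one (hG : G.IsTree) {o u u' v : V} (h : G.Adj u v) (h' : G.Adj u' v)
    (hu : G.dist o u + 1 = G.dist o v) (hu' : G.dist o u' + 1 = G.dist o v) : u = u' := by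
  obtain ⟨q, hq⟩ := hG.connected.exists_walk_length_eq_dist o u
  have := mem_support_of_dist_add_dist hG (x := o) (y := u') (z := v)
    (by rw [SimpleGraph.dist_eq_one_iff_adj.2 h', hu']) (q.concat h)
  rw [SimpleGraph.Walk.support_concat, List.mem_append, List.mem_singleton] at this
  rcases this with h1 | rfl
  · by_contra hne
    classical
    have h2 := q.length_takeUntil_lt_length h1 (Ne.symm hne)
    have h3 := SimpleGraph.dist_le (q.takeUntil u' h1)
    omega
  · exact absurd h' (G.loopless.irrefl _)

lemma finite_setOf_dist_le [G.LocallyFinite] (hG : G.Connected) (o : V) (n : ℕ) :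
    {v | G.dist o v ≤ n}.Finite := by
  induction n with
  | zero =>
    refine (Set.finite_singleton o).subset fun v hv => ?_
    have : G.dist o v = 0 := Nat.le_zero.1 hv
    exact ((hG.dist_eq_zero_iff).1 this).symm
  | succ n ih =>
    refine (ih.union (ih.biUnion fun v _ => (G.neighborSet v).toFinite)).subset fun v hv => ?_
    rcases Nat.lt_or_ge n (G.dist o v) with h | h
    · have h' : G.dist o v = n + 1 := le_antisymm hv h
      obtain ⟨q, hq⟩ := hG.exists_walk_length_eq_dist o v
      have hnil : ¬ q.Nil := by
        intro hn; rw [← SimpleGraph.Walk.length_eq_zero_iff] at hn; omega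
      refine Or.inr (Set.mem_biUnion (x := q.penultimate) ?_ (q.adj_penultimate hnil))
      have := SimpleGraph.dist_le q.dropLast
      rw [SimpleGraph.Walk.length_dropLast] at this
      simp only [Set.mem_ofPred_eq]; omega
    · exact Or.inl h

lemma countable_of_locallyFinite [G.LocallyFinite] (hG : G.Connected) : Countable V := by
  obtain ⟨o⟩ := hG.nonempty
  have : (⋃ n : ℕ, {v | G.dist o v ≤ n}) = Set.univ :=
    Set.eq_univ_of_forall fun v => Set.mem_iUnion.2 ⟨_, le_refl (G.dist o v)⟩
  rw [← Set.countable_univ_iff, ← this]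
  exact Set.countable_iUnion fun n => (finite_setOf_dist_le hG o n).countable

lemma exists_unique_closer (hG : G.IsTree) {x w : V} (h : x ≠ w) :
    ∃ y, G.Adj x y ∧ G.dist w y + 1 = G.dist w x ∧
      ∀ z, G.Adj x z → z ≠ y → G.dist w z = G.dist w x + 1 := by
  obtain ⟨q, hq⟩ := hG.connected.exists_walk_length_eq_dist w x
  have hpos := hG.connected.pos_dist_of_ne (Ne.symm h)
  have hnil : ¬ q.Nil := by
    intro hn; rw [← SimpleGraph.Walk.length_eq_zero_iff] at hn; omega
  have hadj := q.adj_penultimate hnil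
  have hd : G.dist w q.penultimate + 1 = G.dist w x := by
    have h1 := SimpleGraph.dist_le q.dropLast
    rw [SimpleGraph.Walk.length_dropLast] at h1
    rcases hG.dist_eq_dist_add_one_of_adj w hadj with h2 | h2 <;> omega
  refine ⟨q.penultimate, hadj.symm, hd, fun z hz hne => ?_⟩
  rcases hG.dist_eq_dist_add_one_of_adj w hz with h2 | h2
  · exact absurd (eq_of_adj_of_dist_add_one hG hz.symm hadj h2.symm hd) hne
  · exact h2

lemma sum_neighborFinset_dist [G.LocallyFinite] (hG : G.IsTree) {d : ℕ}
    (hreg : G.IsRegularOfDegree (d + 1)) {x w : V} (h : x ≠ w) (f : ℕ → ℝ) :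
    ∑ y ∈ G.neighborFinset x, f (G.dist w y) =
      f (G.dist w x - 1) + d * f (G.dist w x + 1) := by
  classical
  obtain ⟨y, hy, hd, hz⟩ := exists_unique_closer hG h
  have hmem : y ∈ G.neighborFinset x := by simpa using hy
  rw [← Finset.add_sum_erase _ _ hmem, ← hd, Nat.add_sub_cancel]
  congr 1
  rw [Finset.sum_congr rfl (g := fun _ => f (G.dist w x + 1)) fun z hz' => ?_, Finset.sum_const,
    Finset.card_erase_of_mem hmem, SimpleGraph.card_neighborFinset_eq_degree, hreg x, hd,
    nsmul_eq_mul]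
  · simp
  · simp only [Finset.mem_erase, SimpleGraph.mem_neighborFinset] at hz'
    rw [hz z hz'.2 hz'.1]

lemma exists_children [G.LocallyFinite] (hG : G.IsTree) {d : ℕ}
    (hreg : G.IsRegularOfDegree (d + 1)) (o v : V) :
    ∃ c : Fin d → V, Function.Injective c ∧
      ∀ a, G.Adj v (c a) ∧ G.dist o (c a) = G.dist o v + 1 := by
  classical
  obtain ⟨s, hs, hsd⟩ : ∃ s : Finset V, d ≤ s.card ∧
      ∀ y ∈ s, G.Adj v y ∧ G.dist o y = G.dist o v + 1 := by
    by_cases h : v = o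
    · subst h
      refine ⟨G.neighborFinset v, ?_, fun y hy => ?_⟩
      · rw [SimpleGraph.card_neighborFinset_eq_degree, hreg v]; omega
      · have : G.Adj v y := by simpa using hy
        exact ⟨this, by simp [SimpleGraph.dist_eq_one_iff_adj.2 this]⟩
    · obtain ⟨y, hy, -, hz⟩ := exists_unique_closer hG h
      refine ⟨(G.neighborFinset v).erase y, ?_, fun z hz' => ?_⟩
      · rw [Finset.card_erase_of_mem (by simpa using hy),
          SimpleGraph.card_neighborFinset_eq_degree, hreg v]; omega
      · simp only [Finset.mem_erase, SimpleGraph.mem_neighborFinset] at hz'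
        exact ⟨hz'.2, hz z hz'.2 hz'.1⟩
  -- At `v = o` all `d + 1` neighbours qualify; any `d` of them serve.
  obtain ⟨e⟩ : Nonempty (Fin d ↪ s) :=
    Function.Embedding.nonempty_of_card_le (by simpa using hs)
  exact ⟨fun a => e a, Subtype.val_injective.comp e.injective, fun a => hsd _ (e a).2⟩

/-- A `(d + 1)`-regular tree contains a copy of the rooted `d`-ary tree, with any given root. -/
lemma exists_word_embedding [G.LocallyFinite] (hG : G.IsTree) {d : ℕ}
    (hreg : G.IsRegularOfDegree (d + 1)) (o : V) :
    ∃ f : List (Fin d) → V, f [] = o ∧ Function.Injective f ∧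
      ∀ l s, G.dist (f l) (f (s ++ l)) = s.length := by
  choose c hc hadj using exists_children hG hreg o
  obtain ⟨f, hf, hcons⟩ : ∃ f : List (Fin d) → V, f [] = o ∧
      ∀ a l, f (a :: l) = c (f l) a :=
    ⟨fun l => l.rec o fun a _ v => c v a, rfl, fun _ _ => rfl⟩
  have hlen (l : List (Fin d)) : G.dist o (f l) = l.length := by
    induction l with
    | nil => simp [hf]
    | cons a l ih => rw [hcons, (hadj _ _).2, ih, List.length_cons]
  refine ⟨f, hf, fun l l' h => ?_, fun l s => le_antisymm ?_ ?_⟩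
  · induction l generalizing l' with
    | nil =>
      have := hlen l'
      rw [← h, hlen] at this
      exact (List.eq_nil_of_length_eq_zero this.symm).symm
    | cons a l ih =>
      cases l' with
      | nil =>
        have := hlen (a :: l)
        rw [h, hlen] at this
        simp at this
      | cons a' l' =>
        have h1 := hlen (a :: l)
        rw [h, hlen] at h1
        rw [hcons, hcons] at h
        have h2 : f l = f l' := by
          refine eq_of_adj_of_dist_add_one hG (o := o) (v := c (f l) a) (hadj _ _).1 ?_ ?_ ?_
          · rw [h]; exact (hadj _ _).1
          · rw [(hadj _ _).2]
          · rw [h, (hadj _ _).2]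
        obtain rfl := ih _ h2
        rw [hc _ h]
  · induction s with
    | nil => simp
    | cons a s ih =>
      have h1 := hG.connected.dist_triangle (u := f l) (v := f (s ++ l)) (w := f (a :: s ++ l))
      have h2 : G.dist (f (s ++ l)) (f (a :: s ++ l)) = 1 :=
        by
        rw [List.cons_append, hcons]
        exact SimpleGraph.dist_eq_one_iff_adj.2 (hadj _ _).1
      simp only [List.length_cons]; omega
  -- The distance is at least the difference of the depths below `o`.
  · have h1 := hG.connected.dist_triangle (u := o) (v := f l) (w := f (s ++ l))
    rw [hlen, hlen, List.length_append] at h1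
    omega

end Tree

/-! ### The Markov property at the first jump. -/

section Shift

/-- The first map is independent of the shifted sequence, which keeps the same law; this is what
first-step analysis of the walk needs. -/
lemma map_prod_cons_infinitePi {X : Type*} [MeasurableSpace X] (κ : Measure X)
    [IsProbabilityMeasure κ] :
    (κ.prod (Measure.infinitePi fun _ : ℕ => κ)).map
      (fun q n => Nat.casesOn (motive := fun _ => X) n q.1 q.2) =
      Measure.infinitePi fun _ : ℕ => κ := by
  have hmeas : Measurable fun (q : X × (ℕ → X)) (n : ℕ) =>
      Nat.casesOn (motive := fun _ => X) n q.1 q.2 := by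
    refine measurable_pi_iff.2 fun n => ?_
    cases n with
    | zero => exact measurable_fst
    | succ n => exact (measurable_pi_apply n).comp measurable_snd
  refine Measure.eq_infinitePi _ fun s t ht => ?_
  classical
  obtain ⟨N, hN⟩ : ∃ N, s ⊆ Finset.range (N + 1) :=
    ⟨s.sup id, fun i hi => Finset.mem_range.2 (Nat.lt_succ_of_le (Finset.le_sup (f := id) hi))⟩
  set t' : ℕ → Set X := fun i => if i ∈ s then t i else Set.univ with ht'
  have hset : Set.pi (s : Set ℕ) t = Set.pi (Finset.range (N + 1) : Set ℕ) t' := by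
    ext φ
    refine ⟨fun h i _ => ?_, fun h i hi => ?_⟩
    · by_cases hi : i ∈ s
      · simpa [ht', hi] using h i hi
      · simp [ht', hi]
    · have := h i (hN hi)
      rw [Finset.mem_coe] at hi
      simpa [ht', hi] using this
  have hprod : ∏ i ∈ s, κ (t i) = ∏ i ∈ Finset.range (N + 1), κ (t' i) := by
    rw [← Finset.prod_subset hN fun i _ hi => by simp [ht', hi]]
    exact Finset.prod_congr rfl fun i hi => by simp [ht', hi]
  have htm (i : ℕ) : MeasurableSet (t' i) := by
    simp only [ht']
    split_ifs with h
    · exact ht i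
    · exact MeasurableSet.univ
  have hpre : (fun (q : X × (ℕ → X)) (n : ℕ) =>
      Nat.casesOn (motive := fun _ => X) n q.1 q.2) ⁻¹' Set.pi (Finset.range (N + 1) : Set ℕ) t' =
      t' 0 ×ˢ Set.pi (Finset.range N : Set ℕ) (fun i => t' (i + 1)) := by
    ext ⟨ψ, φ⟩
    simp only [Set.mem_preimage, Set.mem_pi, Finset.mem_coe, Finset.mem_range, Set.mem_prod]
    refine ⟨fun h => ⟨h 0 (by omega), fun i hi => h (i + 1) (by omega)⟩, fun h i hi => ?_⟩
    cases i with
    | zero => exact h.1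
    | succ i => exact h.2 i (by omega)
  rw [hset, hprod, Measure.map_apply hmeas (MeasurableSet.pi (Finset.countable_toSet _)
    fun i _ => htm i), hpre, Measure.prod_prod,
    Measure.infinitePi_pi (μ := fun _ : ℕ => κ) fun i _ => htm (i + 1),
    Finset.prod_range_succ', mul_comm]

lemma walk_succ' {V : Type*} (φ : ℕ → V → V) (v : V) (n : ℕ) :
    walk φ v (n + 1) = walk (fun i => φ (i + 1)) (φ 0 v) n := by
  induction n with
  | zero => rfl
  | succ n ih => rw [walk, ih]; rfl

end Shift

/-! ### Hitting probabilities of the walk within a given number of steps. -/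

section Moves

variable {V : Type*} [MeasurableSpace V] [DiscreteMeasurableSpace V]

/-- The law of the maps that drive a simple random walk on `G`. -/
noncomputable def moveLaw (G : SimpleGraph V) : Measure (ℕ → V → V) :=
  Measure.infinitePi fun _ : ℕ => Measure.infinitePi fun x : V => uniformOn (G.neighborSet x)

/-- The event that the walk started at `x` visits `w` within `k` steps. -/
def visitsWithin (w : V) (k : ℕ) (x : V) : Set (ℕ → V → V) := {φ | ∃ n ≤ k, walk φ x n = w}

lemma measurable_walk [Countable V] (x : V) (n : ℕ) :
    Measurable fun φ : ℕ → V → V => walk φ x n := by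
  induction n with
  | zero => exact measurable_const
  | succ n ih =>
    refine measurable_to_countable' fun v => ?_
    have : (fun φ : ℕ → V → V => walk φ x (n + 1)) ⁻¹' {v} =
        ⋃ u, ((fun φ : ℕ → V → V => walk φ x n) ⁻¹' {u}) ∩
          ((fun φ : ℕ → V → V => φ n u) ⁻¹' {v}) := by
      ext φ
      simp [walk]
    rw [this]
    refine MeasurableSet.iUnion fun u => (ih (MeasurableSet.singleton u)).inter ?_
    exact ((measurable_pi_apply u).comp (measurable_pi_apply n)) (MeasurableSet.singleton v)

lemma measurableSet_visitsWithin [Countable V] (w : V) (k : ℕ) (x : V) :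
    MeasurableSet (visitsWithin w k x) := by
  have : visitsWithin w k x = ⋃ n ∈ Finset.range (k + 1), (fun φ => walk φ x n) ⁻¹' {w} := by
    ext φ; simp [visitsWithin]
  rw [this]
  exact Finset.measurableSet_biUnion _ fun n _ => measurable_walk x n (MeasurableSet.singleton w)

variable {G : SimpleGraph V} [G.LocallyFinite]

lemma lintegral_uniformOn_neighborSet (x : V) (f : V → ℝ≥0∞) :
    ∫⁻ y, f y ∂(uniformOn (G.neighborSet x)) =
      (G.degree x : ℝ≥0∞)⁻¹ * ∑ y ∈ G.neighborFinset x, f y := by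
  rw [uniformOn, ProbabilityTheory.cond, lintegral_smul_measure, ← SimpleGraph.coe_neighborFinset,
    lintegral_finset, Measure.count_apply_finset]
  simp

lemma isProbabilityMeasure_uniformOn_neighborSet {x : V} (hx : G.degree x ≠ 0) :
    IsProbabilityMeasure (uniformOn (G.neighborSet x)) :=
  isProbabilityMeasure_uniformOn (G.neighborSet x).toFinite (by
    rw [← SimpleGraph.coe_neighborFinset, Finset.coe_nonempty, ← Finset.card_pos]
    simpa [Nat.pos_iff_ne_zero] using hx)

lemma isProbabilityMeasure_moveLaw (hG : ∀ x, G.degree x ≠ 0) :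
    IsProbabilityMeasure (moveLaw G) := by
  have (x : V) := isProbabilityMeasure_uniformOn_neighborSet (hG x)
  unfold moveLaw
  infer_instance

lemma ae_moveLaw_adj [Countable V] (hG : ∀ x, G.degree x ≠ 0) :
    ∀ᵐ φ ∂(moveLaw G), ∀ n x, G.Adj x (φ n x) := by
  have (x : V) := isProbabilityMeasure_uniformOn_neighborSet (hG x)
  refine ae_all_iff.2 fun n => ae_all_iff.2 fun x => ?_
  have h1 : ∀ᵐ ψ ∂(Measure.infinitePi fun x : V => uniformOn (G.neighborSet x)),
      G.Adj x (ψ x) := by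
    have hmp := measurePreserving_eval_infinitePi (fun x : V => uniformOn (G.neighborSet x)) x
    refine hmp.quasiMeasurePreserving.ae (p := fun y => G.Adj x y) ?_
    have hself := uniformOn_self (G.neighborSet x).toFinite (s := G.neighborSet x) (by
      rw [← SimpleGraph.coe_neighborFinset, Finset.coe_nonempty, ← Finset.card_pos]
      simpa [Nat.pos_iff_ne_zero] using hG x)
    exact (prob_compl_eq_zero_iff (MeasurableSet.of_discrete)).2 hself
  exact (measurePreserving_eval_infinitePi (fun _ : ℕ =>
    Measure.infinitePi fun x : V => uniformOn (G.neighborSet x)) n).quasiMeasurePreserving.ae h1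

lemma measure_visitsWithin_succ [Countable V] (hG : ∀ x, G.degree x ≠ 0) {w x : V} (hx : x ≠ w)
    (k : ℕ) : moveLaw G (visitsWithin w (k + 1) x) =
      (G.degree x : ℝ≥0∞)⁻¹ * ∑ y ∈ G.neighborFinset x, moveLaw G (visitsWithin w k y) := by
  have (x : V) := isProbabilityMeasure_uniformOn_neighborSet (hG x)
  have hmeas : Measurable fun (q : (V → V) × (ℕ → V → V)) (n : ℕ) =>
      Nat.casesOn (motive := fun _ => V → V) n q.1 q.2 := by
    refine measurable_pi_iff.2 fun n => ?_
    cases n with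
    | zero => exact measurable_fst
    | succ n => exact (measurable_pi_apply n).comp measurable_snd
  set κ := Measure.infinitePi fun x : V => uniformOn (G.neighborSet x) with hκ
  have hlaw : moveLaw G = Measure.infinitePi fun _ : ℕ => κ := rfl
  conv_lhs => rw [hlaw, ← map_prod_cons_infinitePi κ]
  rw [Measure.map_apply hmeas (measurableSet_visitsWithin _ _ _),
    Measure.prod_apply (hmeas (measurableSet_visitsWithin _ _ _))]
  have hsec (ψ : V → V) : Prod.mk ψ ⁻¹' ((fun (q : (V → V) × (ℕ → V → V)) (n : ℕ) =>
      Nat.casesOn (motive := fun _ => V → V) n q.1 q.2) ⁻¹' visitsWithin w (k + 1) x) =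
      visitsWithin w k (ψ x) := by
    ext φ
    simp only [Set.mem_preimage, visitsWithin, Set.mem_ofPred_eq]
    constructor
    · rintro ⟨n, hn, h⟩
      cases n with
      | zero => exact absurd h hx
      | succ n => exact ⟨n, by omega, by rwa [walk_succ'] at h⟩
    · rintro ⟨n, hn, h⟩
      exact ⟨n + 1, by omega, by rwa [walk_succ']⟩
  simp_rw [hsec]
  rw [← lintegral_uniformOn_neighborSet,
    ← (measurePreserving_eval_infinitePi (fun x : V => uniformOn (G.neighborSet x)) x).lintegral_comp
      (f := fun y => moveLaw G (visitsWithin w k y)) Measurable.of_discrete]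
  rfl

end Moves

/-- By `hpb`, `b ^ dist` solves the same boundary problem as `H`. Both functions lie in `[0, 1]`,
and each use of the equation contracts their difference by `p < 1`. -/
lemma eq_pow_dist_of_harmonic {V : Type*} {G : SimpleGraph V} [G.LocallyFinite] (hG : G.IsTree)
    {d : ℕ} (hreg : G.IsRegularOfDegree (d + 1)) {p b : ℝ} (hp0 : 0 ≤ p) (hp1 : p < 1)
    (hb0 : 0 ≤ b) (hb1 : b ≤ 1) (hpb : p * (1 + d * b ^ 2) = (d + 1) * b) {w : V} {H : V → ℝ}
    (hH0 : ∀ x, 0 ≤ H x) (hH1 : ∀ x, H x ≤ 1) (hw : H w = 1)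
    (hH : ∀ x, x ≠ w → H x = p * ((d + 1 : ℝ)⁻¹ * ∑ y ∈ G.neighborFinset x, H y)) (x : V) :
    H x = b ^ G.dist w x := by
  have hd : (0 : ℝ) < d + 1 := by positivity
  have hb (x : V) (hx : x ≠ w) : b ^ G.dist w x =
      p * ((d + 1 : ℝ)⁻¹ * ∑ y ∈ G.neighborFinset x, b ^ G.dist w y) := by
    rw [sum_neighborFinset_dist hG hreg hx fun k => b ^ k]
    obtain ⟨k, hk⟩ : ∃ k, G.dist w x = k + 1 :=
      ⟨G.dist w x - 1, by have := hG.connected.pos_dist_of_ne hx.symm; omega⟩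
    rw [hk, Nat.add_sub_cancel]
    field_simp
    rw [pow_succ, pow_succ, pow_succ]
    linear_combination (-b ^ k) * hpb
  have key (n : ℕ) : ∀ x, |H x - b ^ G.dist w x| ≤ p ^ n := by
    induction n with
    | zero =>
      intro x
      rw [pow_zero, abs_le]
      have h1 : b ^ G.dist w x ≤ 1 := pow_le_one₀ hb0 hb1
      have h2 : 0 ≤ b ^ G.dist w x := by positivity
      constructor <;> linarith [hH0 x, hH1 x]
    | succ n ih =>
      intro x
      by_cases hx : x = w
      · subst hx
        simp [hw]; positivity
      · rw [hH x hx, hb x hx, ← mul_sub, ← mul_sub, ← Finset.sum_sub_distrib, abs_mul, abs_mul,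
          abs_of_nonneg hp0, abs_of_pos (inv_pos.2 hd), pow_succ']
        refine mul_le_mul_of_nonneg_left ?_ hp0
        rw [inv_mul_le_iff₀ hd]
        refine (Finset.abs_sum_le_sum_abs _ _).trans
          ((Finset.sum_le_sum fun y _ => ih y).trans_eq ?_)
        rw [Finset.sum_const, SimpleGraph.card_neighborFinset_eq_degree, hreg x, nsmul_eq_mul]
        push_cast; ring
  have hlim := tendsto_pow_atTop_nhds_zero_of_lt_one hp0 hp1
  have := ge_of_tendsto' hlim fun n => key n x
  exact sub_eq_zero.1 (abs_eq_zero.1 (le_antisymm this (abs_nonneg _)))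

/-! ### Visits of a particle with geometric lifetime. -/

section ParticleLaw

variable {V : Type*} {G : SimpleGraph V}

/-- The set of the particles which, started at `x`, move along the edges of `G` and visit `w`. -/
def visits (G : SimpleGraph V) (x w : V) : Set (Particle V) :=
  {π | (∀ n u, G.Adj u (π.moves n u)) ∧ ∃ n ≤ π.lifetime, walk π.moves x n = w}

/-- The walk must pass through every vertex of the geodesic. Requiring adjacency in `visits` makes
this hold surely, not just almost surely. -/
lemma visits_subset (hG : G.IsTree) {x y z : V} (h : G.dist x y + G.dist y z = G.dist x z) :
    visits G x z ⊆ visits G x y := by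
  rintro π ⟨hadj, n, hn, hz⟩
  refine ⟨hadj, ?_⟩
  have key (n : ℕ) : ∃ v, v = walk π.moves x n ∧ ∃ q : G.Walk x v,
      ∀ u ∈ q.support, ∃ k ≤ n, walk π.moves x k = u := by
    induction n with
    | zero =>
      refine ⟨x, rfl, SimpleGraph.Walk.nil, fun u hu => ⟨0, le_rfl, ?_⟩⟩
      rw [SimpleGraph.Walk.support_nil, List.mem_singleton] at hu
      exact hu.symm
    | succ n ih =>
      obtain ⟨v, hv, q, hq⟩ := ih
      refine ⟨π.moves n v, by rw [hv]; rfl, q.concat (hadj n v), fun u hu => ?_⟩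
      rw [SimpleGraph.Walk.support_concat, List.mem_append, List.mem_singleton] at hu
      rcases hu with hu | rfl
      · obtain ⟨k, hk, h⟩ := hq u hu
        exact ⟨k, by omega, h⟩
      · exact ⟨n + 1, le_rfl, by rw [hv]; rfl⟩
  obtain ⟨v, hv, q, hq⟩ := key n
  obtain rfl : v = z := hv.trans hz
  obtain ⟨k, hk, hy⟩ := hq y (mem_support_of_dist_add_dist hG h q)
  exact ⟨k, hk.trans hn, hy⟩

lemma measurableSet_visits [Countable V] (x w : V) : MeasurableSet (visits G x w) := by
  let _ : MeasurableSpace V := ⊤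
  have h1 : Measurable (Particle.moves : Particle V → ℕ → V → V) := measurable_fst
  have h2 : Measurable (Particle.lifetime : Particle V → ℕ) := measurable_snd
  have : visits G x w = (⋂ n, ⋂ u, Particle.moves ⁻¹' {φ | G.Adj u (φ n u)}) ∩
      ⋃ n, (Particle.lifetime ⁻¹' Set.Ici n) ∩ Particle.moves ⁻¹' {φ | walk φ x n = w} := by
    ext π
    simp [visits]
  rw [this]
  refine MeasurableSet.inter (MeasurableSet.iInter fun n => MeasurableSet.iInter fun u => h1 ?_)
    (MeasurableSet.iUnion fun n => (h2 MeasurableSet.of_discrete).inter (h1 ?_))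
  · exact ((measurable_pi_apply u).comp (measurable_pi_apply n))
      (MeasurableSet.of_discrete (s := {y | G.Adj u y}))
  · exact measurable_walk x n (MeasurableSet.singleton w)

variable [G.LocallyFinite] {p : unitInterval}

lemma isProbabilityMeasure_particleLaw (hG : ∀ x, G.degree x ≠ 0) :
    IsProbabilityMeasure (particleLaw G p) := by
  let _ : MeasurableSpace V := ⊤
  have := isProbabilityMeasure_moveLaw hG
  exact inferInstanceAs (IsProbabilityMeasure
    ((moveLaw G).prod (geometricMeasure (unitInterval.symm p))))

/-- Summing over the lifetime, the geometric law contributes a factor `p` for surviving until the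
first jump, so the visiting probability satisfies the equation of `eq_pow_dist_of_harmonic`. -/
lemma measureReal_visits [Countable V] (hG : G.IsTree) {d : ℕ}
    (hreg : G.IsRegularOfDegree (d + 1)) (hp1 : p < 1) {b : ℝ} (hb0 : 0 ≤ b) (hb1 : b ≤ 1)
    (hpb : (p : ℝ) * (1 + d * b ^ 2) = (d + 1) * b) (x w : V) :
    (particleLaw G p).real (visits G x w) = b ^ G.dist w x := by
  let _ : MeasurableSpace V := ⊤
  have hdeg (x : V) : G.degree x ≠ 0 := by rw [hreg x]; omega
  have := isProbabilityMeasure_moveLaw hdeg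
  set γ := geometricMeasure (unitInterval.symm p) with hγ
  have hlaw : particleLaw G p = (moveLaw G).prod γ := rfl
  have hp1' : (p : ℝ) < 1 := hp1
  have hsymm : unitInterval.symm p ≠ 0 := by
    intro h
    have : (1 : ℝ) - p = 0 := congrArg Subtype.val h
    linarith
  have hγn (n : ℕ) : γ {n} = ENNReal.ofReal ((p : ℝ) ^ n * (1 - p)) := by
    rw [hγ, geometricMeasure_singleton hsymm]
    simp
  set h : ℕ → V → ℝ := fun k y => (moveLaw G).real (visitsWithin w k y) with hh
  have hsum (y : V) : HasSum (fun k => (p : ℝ) ^ k * (1 - p) * h k y)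
      ((particleLaw G p).real (visits G y w)) := by
    have hslice (k : ℕ) : moveLaw G ((fun φ => ((φ, k) : Particle V)) ⁻¹' visits G y w) =
        moveLaw G (visitsWithin w k y) := by
      refine measure_congr ?_
      filter_upwards [ae_moveLaw_adj hdeg] with φ hφ
      exact propext ⟨fun h => h.2, fun h => ⟨hφ, h⟩⟩
    have htsum : particleLaw G p (visits G y w) =
        ∑' k, moveLaw G (visitsWithin w k y) * γ {k} := by
      have h1 : particleLaw G p (visits G y w) =
          ∫⁻ k, moveLaw G ((fun φ => ((φ, k) : Particle V)) ⁻¹' visits G y w) ∂γ :=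
        Measure.prod_apply_symm (μ := moveLaw G) (ν := γ) (measurableSet_visits (G := G) y w)
      rw [h1, lintegral_countable']
      simp_rw [hslice]
    have hfin : ∑' k, moveLaw G (visitsWithin w k y) * γ {k} ≠ ∞ := by
      have := isProbabilityMeasure_particleLaw (p := p) hdeg
      rw [← htsum]; exact measure_ne_top _ _
    have h2 := ENNReal.hasSum_toReal hfin
    rw [← ENNReal.tsum_toReal_eq (fun k => ENNReal.ne_top_of_tsum_ne_top hfin k), ← htsum] at h2
    convert! h2 using 2 with k
    rw [ENNReal.toReal_mul, hγn, ENNReal.toReal_ofReal, mul_comm]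
    · rfl
    · exact mul_nonneg (pow_nonneg p.2.1 _) (by linarith)
  have h0 (y : V) (hy : y ≠ w) : h 0 y = 0 := by
    have : visitsWithin w 0 y = ∅ := by
      ext φ
      simp [visitsWithin, walk, hy]
    simp [hh, this]
  have hw (k : ℕ) : h k w = 1 := by
    have : visitsWithin w k w = Set.univ :=
      Set.eq_univ_of_forall fun φ => ⟨0, Nat.zero_le _, rfl⟩
    simp [hh, this]
  have hsucc (k : ℕ) (y : V) (hy : y ≠ w) :
      h (k + 1) y = (d + 1 : ℝ)⁻¹ * ∑ z ∈ G.neighborFinset y, h k z := by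
    simp only [hh, Measure.real]
    rw [measure_visitsWithin_succ hdeg hy, ENNReal.toReal_mul,
      ENNReal.toReal_sum fun _ _ => measure_ne_top _ _, hreg y, ENNReal.toReal_inv,
      ENNReal.toReal_natCast]
    push_cast; rfl
  have hprob := isProbabilityMeasure_particleLaw (p := p) hdeg
  refine eq_pow_dist_of_harmonic hG hreg (H := fun y => (particleLaw G p).real (visits G y w))
    p.2.1 hp1' hb0 hb1 hpb (fun _ => measureReal_nonneg) (fun _ => measureReal_le_one) ?_ ?_ x
  · refine (hsum w).unique ?_
    simp only [hw, mul_one]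
    have := (hasSum_geometric_of_lt_one p.2.1 hp1').mul_right (1 - (p : ℝ))
    rwa [inv_mul_cancel₀ (by linarith)] at this
  · intro y hy
    have h1 := (hasSum_nat_add_iff' 1).2 (hsum y)
    simp only [Finset.sum_range_one, h0 y hy, mul_zero, sub_zero] at h1
    refine h1.unique ?_
    have h2 := ((hasSum_sum (s := G.neighborFinset y) fun z _ => hsum z).mul_left
      (d + 1 : ℝ)⁻¹).mul_left (p : ℝ)
    convert! h2 using 2 with k
    rw [hsucc k y hy, ← Finset.mul_sum, pow_succ]
    ring

end ParticleLaw

/-! ### From infinitely many activated vertices to survival. -/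

section Survival

variable {V : Type*}

/-- Links with zero jumps stay put, so at most `t` links of a chain matter, each with finitely many
possible lengths. -/
lemma finite_setOf_reaches_le (o : V) (ω : V → Particle V) (t : ℕ) :
    {v | ∃ s ≤ t, Reaches o ω v s}.Finite := by
  obtain ⟨Q, hQ0, hQsucc⟩ : ∃ Q : ℕ → Set V, Q 0 = {o} ∧ ∀ k, Q (k + 1) =
      Q k ∪ ⋃ u ∈ Q k, ⋃ n ∈ Set.Iic (k + 1), {walk (ω u).moves u n} :=
    ⟨fun k => k.rec {o} fun k S => S ∪ ⋃ u ∈ S, ⋃ n ∈ Set.Iic (k + 1), {walk (ω u).moves u n},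
      rfl, fun _ => rfl⟩
  have hQfin (n : ℕ) : (Q n).Finite := by
    induction n with
    | zero => rw [hQ0]; exact Set.finite_singleton o
    | succ n ih =>
      rw [hQsucc]
      exact ih.union (ih.biUnion fun u _ =>
        (Set.finite_Iic _).biUnion fun _ _ => Set.finite_singleton _)
  have hQmono : Monotone Q := monotone_nat_of_le_succ fun n => by
    rw [hQsucc]; exact Set.subset_union_left
  have hQ (k : ℕ) (u : V) (hu : u ∈ Q k) (n : ℕ) (hn : n ≤ k + 1) :
      walk (ω u).moves u n ∈ Q (k + 1) := by
    rw [hQsucc]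
    exact Or.inr (Set.mem_biUnion hu (Set.mem_biUnion hn rfl))
  have key {v : V} {s : ℕ} (h : Reaches o ω v s) : v ∈ Q s := by
    induction h with
    | root => rw [hQ0]; rfl
    | @step v t n _ _ ih =>
      cases n with
      | zero => exact ih
      | succ n => exact hQ (t + n) v (hQmono (Nat.le_add_right t n) ih) (n + 1) (by omega)
  exact (hQfin t).subset fun v ⟨s, hs, h⟩ => hQmono hs (key h)

/-- If no particle is active at time `t`, those activated by then are removed before `t`, so nothing
new is ever reached after `t`. -/
lemma survives_of_infinite {o : V} {ω : V → Particle V}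
    (h : {v | ∃ s, Reaches o ω v s}.Infinite) : Survives o ω := by
  intro t
  by_contra! hcon
  refine h ((finite_setOf_reaches_le o ω t).subset ?_)
  rintro v ⟨s, hs⟩
  induction hs with
  | root => exact ⟨0, Nat.zero_le _, Reaches.root⟩
  | @step v s n _ hn ih =>
    classical
    obtain ⟨s', hs', hr⟩ := ih
    have hex : ∃ s, Reaches o ω v s := ⟨s', hr⟩
    have hle : Nat.find hex ≤ t := (Nat.find_min' hex hr).trans hs'
    refine ⟨Nat.find hex + n, ?_, Reaches.step (Nat.find_spec hex) hn⟩
    by_contra hlt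
    exact hcon v ⟨Nat.find hex, ⟨Nat.find_spec hex, fun _ h => Nat.find_min' hex h⟩, hle, by omega⟩

/-- If an active particle visits a given neighbour with probability `b`, then the frog model
survives as soon as the mean number of the vertices last hit by a given particle exceeds `1`. -/
theorem mem_supercritical_of_one_lt {G : SimpleGraph V} [G.LocallyFinite] (hG : G.IsTree) {d : ℕ}
    (hreg : G.IsRegularOfDegree (d + 1)) (o : V) {b : ℝ} (hb0 : 0 < b) (hb1 : b < 1)
    (hdb : d * b < 1) {N : ℕ}
    (hN : 1 < ∑ i ∈ Finset.range N, (d : ℝ) ^ (i + 1) * lastHit b i) :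
    (d + 1) * b / (1 + d * b ^ 2) ∈ supercritical G o := by
  have := countable_of_locallyFinite hG.connected
  have hden : 0 < 1 + d * b ^ 2 := by positivity
  have hp0 : 0 < (d + 1) * b / (1 + d * b ^ 2) := by positivity
  have hp1 : (d + 1) * b / (1 + d * b ^ 2) < 1 := by
    rw [div_lt_one hden]
    -- `1 + d b ^ 2 - (d + 1) b = (1 - b) (1 - d b)`.
    nlinarith [mul_pos (sub_pos.2 hb1) (sub_pos.2 hdb)]
  set p : unitInterval := ⟨(d + 1) * b / (1 + d * b ^ 2), hp0.le, hp1.le⟩ with hp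
  have hdeg (x : V) : G.degree x ≠ 0 := by rw [hreg x]; omega
  have hprob := isProbabilityMeasure_particleLaw (p := p) hdeg
  obtain ⟨f, hf0, hfinj, hfdist⟩ := exists_word_embedding hG hreg o
  have hmono (l s t : List (Fin d)) :
      visits G (f l) (f (t ++ s ++ l)) ⊆ visits G (f l) (f (s ++ l)) := by
    refine visits_subset hG ?_
    rw [hfdist, hfdist, List.append_assoc, hfdist, List.length_append, add_comm]
  have hind : iIndep (fun l : List (Fin d) => MeasurableSpace.comap
      (fun ω : V → Particle V => ω (f l)) inferInstance) (frogLaw G p) :=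
    (iIndepFun_infinitePi (P := fun _ : V => particleLaw G p) (X := fun _ π => π)
      fun _ => measurable_id).precomp hfinj
  have hpr : IsProbabilityMeasure (frogLaw G p) := by unfold frogLaw; infer_instance
  obtain ⟨S, hS, hSR⟩ := exists_measure_pos_of_one_lt (μ := frogLaw G p)
    (A := fun l s => {ω | ω (f l) ∈ visits G (f l) (f (s ++ l))})
    (fun l => (measurable_pi_apply (f l)).comap_le) hind
    (fun l s => ⟨_, measurableSet_visits (f l) (f (s ++ l)), rfl⟩)
    (fun l s => by
      have h1 := (measurePreserving_eval_infinitePi (fun _ : V => particleLaw G p)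
        (f l)).measureReal_preimage
          (measurableSet_visits (G := G) (f l) (f (s ++ l))).nullMeasurableSet
      refine h1.trans ?_
      rw [measureReal_visits hG hreg hp1 hb0.le hb1.le _ (f l), SimpleGraph.dist_comm, hfdist]
      rw [hp]; field_simp)
    hb0 hb1.le (fun l s t ω hω => hmono l s t hω) (N := N) (by simpa using hN)
  refine ⟨p, rfl, hp0, hp1, hS.trans_le (measure_mono fun ω hω => survives_of_infinite fun hfin => ?_)⟩
  have hfin' := (hfin.preimage hfinj.injOn).image List.length
  obtain ⟨K, hK⟩ := hfin'.bddAbove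
  obtain ⟨s, hs, hlen⟩ := hSR ω hω (fun l => ∃ t, Reaches o ω (f l) t)
    ⟨0, by rw [hf0]; exact Reaches.root⟩ (by
      rintro l s ⟨t, ht⟩ ⟨-, n, hn, hw⟩
      refine ⟨t + n, ?_⟩
      rw [← hw]
      exact Reaches.step ht hn) (K + 1)
  have := hK ⟨s, hs, rfl⟩
  omega

end Survival

/-! ### Explicit values of `b`. -/

section Numerics

/-- The extra term `b ^ (n + 2)` is what lets the induction close; the bound without it is the one
used later. -/
lemma one_sub_sub_sq_le_prod {b : ℝ} (hb0 : 0 ≤ b) (hb1 : b ≤ 1) (n : ℕ) :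
    1 - b - b ^ 2 + b ^ (n + 2) ≤ ∏ j ∈ Finset.range (n + 1), (1 - b ^ (j + 1)) := by
  induction n with
  | zero => simp
  | succ n ih =>
    rw [Finset.prod_range_succ]
    have h1 : 0 ≤ 1 - b ^ (n + 1 + 1) := sub_nonneg.2 (pow_le_one₀ hb0 hb1)
    refine le_trans ?_ (mul_le_mul_of_nonneg_right ih h1)
    have h2 : b ^ (n + 2) * b ^ (n + 2) ≤ b ^ (n + 2) * b ^ 2 :=
      mul_le_mul_of_nonneg_left (pow_le_pow_of_le_one hb0 hb1 (by omega)) (by positivity)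
    have h3 : b ^ (n + 1 + 2) = b ^ (n + 2) * b := by rw [← pow_succ]
    have h4 : b ^ (n + 1 + 1) = b ^ (n + 2) := rfl
    rw [h3, h4]
    nlinarith

/-- With `x = d b` the sum tends to at least `x + (1 - b - b ^ 2) x ^ 2 / (1 - x)`, and `h` says
exactly that this exceeds `1`. -/
lemma exists_one_lt_sum_lastHit {d b : ℝ} (hb0 : 0 < b) (hb1 : b < 1) (hd : 0 < d)
    (hdb : d * b < 1) (h : (b + b ^ 2) * (d * b) ^ 2 < 2 * (d * b) - 1) :
    ∃ N, 1 < ∑ i ∈ Finset.range N, d ^ (i + 1) * lastHit b i := by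
  set x := d * b with hx
  have hx0 : 0 < x := by positivity
  have hlim : Filter.Tendsto (fun N : ℕ => x + (1 - b - b ^ 2) * x ^ 2 *
      ∑ i ∈ Finset.range N, x ^ i) Filter.atTop
      (nhds (x + (1 - b - b ^ 2) * x ^ 2 * (1 - x)⁻¹)) :=
    ((hasSum_geometric_of_lt_one hx0.le hdb).tendsto_sum_nat.const_mul _).const_add _
  have h1 : 1 < x + (1 - b - b ^ 2) * x ^ 2 * (1 - x)⁻¹ := by
    have : 0 < 1 - x := sub_pos.2 hdb
    rw [← sub_lt_iff_lt_add', ← div_eq_mul_inv, lt_div_iff₀ this]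
    nlinarith
  obtain ⟨N, hN⟩ := (hlim.eventually (lt_mem_nhds h1)).exists
  refine ⟨N + 1, hN.trans_le ?_⟩
  rw [Finset.sum_range_succ', add_comm, Finset.mul_sum]
  refine add_le_add (Finset.sum_le_sum fun i _ => ?_) (by simp [lastHit, hx])
  have h2 := one_sub_sub_sq_le_prod hb0.le hb1.le i
  have h3 : 0 ≤ b ^ (i + 2) := by positivity
  calc (1 - b - b ^ 2) * x ^ 2 * x ^ i = x ^ (i + 2) * (1 - b - b ^ 2) := by ring
    _ ≤ x ^ (i + 2) * ∏ j ∈ Finset.range (i + 1), (1 - b ^ (j + 1)) :=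
        mul_le_mul_of_nonneg_left (by linarith) (by positivity)
    _ = _ := by rw [lastHit, hx]; ring

lemma criticalParam_le {V : Type*} {G : SimpleGraph V} {o : V} {x : ℝ}
    (hx : x ∈ supercritical G o) : criticalParam G o ≤ x :=
  csInf_le ⟨0, fun y ⟨_, hq, h0, _⟩ => by rw [← hq]; exact le_of_lt h0⟩ hx

end Numerics

end FrogModel

theorem proposition2 {V : Type*} (G : SimpleGraph V) [G.LocallyFinite] (o : V) (d : ℕ)
    (hd : 2 ≤ d) (hG : G.IsTree) (hreg : G.IsRegularOfDegree (d + 1)) :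
    (FrogModel.supercritical G o).Nonempty ∧
    (d = 2 → FrogModel.criticalParam G o ≤ 0.720836) ∧
    (3 ≤ d →
      FrogModel.criticalParam G o ≤
        (((d : ℝ) + 1) * ((7 * (d : ℝ) - 1) - √((7 * (d : ℝ) - 1) ^ 2 - 14))) /
          ((d : ℝ) * (7 * (d : ℝ) - 1) ^ 2 - 7 * (d : ℝ) + 2
            - (d : ℝ) * (7 * (d : ℝ) - 1) * √((7 * (d : ℝ) - 1) ^ 2 - 14)) ∧
      (((d : ℝ) + 1) * ((7 * (d : ℝ) - 1) - √((7 * (d : ℝ) - 1) ^ 2 - 14))) /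
          ((d : ℝ) * (7 * (d : ℝ) - 1) ^ 2 - 7 * (d : ℝ) + 2
            - (d : ℝ) * (7 * (d : ℝ) - 1) * √((7 * (d : ℝ) - 1) ^ 2 - 14))
        < ((d : ℝ) + 1) / (2 * (d : ℝ))) := by
  have h2 : d = 2 → ((2 : ℝ) + 1) * 0.277 / (1 + 2 * 0.277 ^ 2) ∈
      FrogModel.supercritical G o := by
    rintro rfl
    have := FrogModel.mem_supercritical_of_one_lt hG hreg o (b := 0.277) (by norm_num)
      (by norm_num) (by norm_num) (N := 7) (by
        simp only [FrogModel.lastHit, Finset.sum_range_succ, Finset.prod_range_succ,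
          Finset.range_zero, Finset.sum_empty, Finset.prod_empty]
        norm_num)
    exact_mod_cast this
  have h3 : 3 ≤ d →
      (((d : ℝ) + 1) * ((7 * (d : ℝ) - 1) - √((7 * (d : ℝ) - 1) ^ 2 - 14))) /
          ((d : ℝ) * (7 * (d : ℝ) - 1) ^ 2 - 7 * (d : ℝ) + 2
            - (d : ℝ) * (7 * (d : ℝ) - 1) * √((7 * (d : ℝ) - 1) ^ 2 - 14)) ∈
        FrogModel.supercritical G o ∧
      (((d : ℝ) + 1) * ((7 * (d : ℝ) - 1) - √((7 * (d : ℝ) - 1) ^ 2 - 14))) /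
          ((d : ℝ) * (7 * (d : ℝ) - 1) ^ 2 - 7 * (d : ℝ) + 2
            - (d : ℝ) * (7 * (d : ℝ) - 1) * √((7 * (d : ℝ) - 1) ^ 2 - 14))
        < ((d : ℝ) + 1) / (2 * (d : ℝ)) := by
    intro hd3
    have hd3' : (3 : ℝ) ≤ d := by exact_mod_cast hd3
    set B : ℝ := 7 * (d : ℝ) - 1 with hB
    have hB20 : 20 ≤ B := by linarith
    set r := √(B ^ 2 - 14) with hr
    have hr2 : r ^ 2 = B ^ 2 - 14 := Real.sq_sqrt (by nlinarith)
    have hr0 : 0 ≤ r := Real.sqrt_nonneg _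
    -- The smaller root of `2b² - 2Bb + 7 = 0`, which is `2db - 1 = (2/7)(b + b²)`: the criterion of
    -- `exists_one_lt_sum_lastHit` at equality, with `(db)²` replaced by `2/7`.
    obtain ⟨b, hb⟩ : ∃ b, b = (B - r) / 2 := ⟨_, rfl⟩
    have hrb : r = B - 2 * b := by linarith
    have hb0 : 0 < b := by
      have : r < B := by nlinarith
      linarith
    have hb1 : b < 0.18 := by
      have : B - 0.36 < r := by nlinarith
      linarith
    have hquad : 2 * b ^ 2 - 2 * B * b + 7 = 0 := by rw [hrb] at hr2; nlinarith
    have hx : d * b = (7 + 2 * b + 2 * b ^ 2) / 14 := by rw [hB] at hquad; linarith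
    have hden : (d : ℝ) * B ^ 2 - 7 * d + 2 - d * B * r = 2 * (1 + d * b ^ 2) := by
      rw [hrb]; linear_combination (d : ℝ) * (-1) * hquad
    have hval : ((d : ℝ) + 1) * (B - r) / ((d : ℝ) * B ^ 2 - 7 * d + 2 - d * B * r) =
        (d + 1) * b / (1 + d * b ^ 2) := by
      rw [hden, hrb]
      have : 0 < 1 + d * b ^ 2 := by positivity
      field_simp
      ring
    rw [hval]
    have hdb1 : d * b < 1 := by rw [hx]; nlinarith
    constructor
    · obtain ⟨N, hN⟩ := FrogModel.exists_one_lt_sum_lastHit (d := d) hb0 (by linarith)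
        (by linarith) hdb1 (by
          -- Since `b < 0.18`, `(db)²` is strictly below `2/7`, so the criterion holds strictly.
          have h4 : d * b < 0.5304 := by rw [hx]; nlinarith
          have h5 : (d * b) ^ 2 < 2 / 7 := by nlinarith [mul_pos (by linarith : (0 : ℝ) < d) hb0]
          have h6 : 2 * (d * b) - 1 = (b + b ^ 2) * (2 / 7) := by rw [hx]; ring
          rw [h6]
          exact mul_lt_mul_of_pos_left h5 (by positivity))
      exact FrogModel.mem_supercritical_of_one_lt hG hreg o hb0 (by linarith) hdb1 hN
    · rw [div_lt_div_iff₀ (by positivity) (by positivity), mul_assoc]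
      refine mul_lt_mul_of_pos_left ?_ (by positivity)
      have h7 : d * b ^ 2 = (d * b) * b := by ring
      have h8 : b * (2 * d) = 2 * (d * b) := by ring
      -- After division by `b`, what is left is `4(1 + b) < 7 + 2b + 2b²`.
      rw [h7, h8, hx]
      nlinarith [mul_pos hb0 hb0]
  refine ⟨?_, fun h => ?_, fun h => ⟨FrogModel.criticalParam_le (h3 h).1, (h3 h).2⟩⟩
  · rcases hd.eq_or_lt with h | h
    · exact ⟨_, h2 h.symm⟩
    · exact ⟨_, (h3 h).1⟩
  · exact (FrogModel.criticalParam_le (h2 h)).trans (by norm_num)
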